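/- Let $T\subseteq\mathbb{R}$ be the field of totally real numbers, i.e. the maximal Galois extension of $\mathbb{Q}$ inside $\mathbb{R}$, and let $\mathcal{O}_T$ be its ring of integers, i.e. the integral closure of $\mathbb{Z}$ in $T$. Let $\mathcal{L}_{ring}=\{+,\cdot\,;0,1\}$ be the first-order language of rings. (a) The first-order theory $\mathrm{Th}(\mathcal{O}_T)$ of the $\mathcal{L}_{ring}$-structure $\mathcal{O}_T$ is undecidable: there is no algorithm which, given (the Gödel number of) an arbitrary $\mathcal{L}_{ring}$-sentence $\alpha$, halts with output YES if $\mathcal{O}_T\models\alpha$ and with output NO otherwise. (b) The set $\mathbb{N}$ of natural numbers is definable in $\mathcal{O}_T$ by an $\mathcal{L}_{ring}$-formula without parameters. (c) For $t\in\mathcal{O}_T$ and $M\in\mathbb{R}$ write $0\ll t\ll M$ if $0<\sigma(t)<M$ for every field embedding $\sigma:T\to\mathbb{R}$. Then $$\min\{M\in\mathbb{R}\mid \text{there are infinitely many } t\in\mathcal{O}_T \text{ with } 0\ll t\ll M\}=4.$$ -/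

import Mathlib

open FirstOrder NumberField

/-- The function symbols of the language of rings `{+, ·; 0, 1}`. -/
inductive RingSymbol : ℕ → Type
  | add : RingSymbol 2
  | mul : RingSymbol 2
  | zero : RingSymbol 0
  | one : RingSymbol 0

/-- The first-order language of rings `{+, ·; 0, 1}` (equality is a logical symbol). -/
def ringLanguage : Language :=
  { Functions := RingSymbol
    Relations := fun _ => Empty }

/-- Every (commutative) ring is a structure for the language of rings, in the obvious way. -/
instance ringLanguageStructure (R : Type*) [CommRing R] : ringLanguage.Structure R where
  funMap := fun {_} f =>
    match f with
    | .add => fun x => x 0 + x 1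
    | .mul => fun x => x 0 * x 1
    | .zero => fun _ => 0
    | .one => fun _ => 1
  RelMap := fun r => r.elim

namespace ringLanguage

/-- The code of a term with a given head symbol, from the codes of its arguments. -/
def symbolCode : {k : ℕ} → RingSymbol k → (Fin k → ℕ) → ℕ
  | _, .zero, _ => Nat.pair 1 0
  | _, .one, _ => Nat.pair 2 0
  | _, .add, c => Nat.pair 3 (Nat.pair (c 0) (c 1))
  | _, .mul, c => Nat.pair 4 (Nat.pair (c 0) (c 1))

/-- The Gödel number of a term in the variables `v₀, …, v_{n-1}`. -/
def termCode {n : ℕ} : ringLanguage.Term (Empty ⊕ Fin n) → ℕ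
  | .var (.inl e) => e.elim
  | .var (.inr i) => Nat.pair 0 i
  | .func f ts => symbolCode f (fun i => termCode (ts i))

/-- The Gödel number of a formula whose free variables are among `v₀, …, v_{n-1}`; the
quantifier `∀` applied to it binds the variable `v_{n-1}`. -/
def formulaCode : {n : ℕ} → ringLanguage.BoundedFormula Empty n → ℕ
  | _, .falsum => Nat.pair 0 0
  | _, .equal s t => Nat.pair 1 (Nat.pair (termCode s) (termCode t))
  | _, .rel r _ => Empty.elim r
  | _, .imp φ ψ => Nat.pair 2 (Nat.pair (formulaCode φ) (formulaCode ψ))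
  | _, .all φ => Nat.pair 3 (formulaCode φ)

/-- The Gödel number of a sentence of the language of rings. -/
def godelNumber (φ : ringLanguage.Sentence) : ℕ := formulaCode φ

theorem termCode_injective {n : ℕ} :
    Function.Injective (termCode : ringLanguage.Term (Empty ⊕ Fin n) → ℕ) := by
  intro s
  induction s with
  | var x =>
    intro t h
    rcases x with e | i
    · exact e.elim
    · rcases t with (e | j) | ⟨g, us⟩
      · exact e.elim
      · simp only [termCode, Nat.pair_eq_pair, true_and] at h
        rw [Fin.ext h]
      · change RingSymbol _ at g
        cases g <;> simp [termCode, symbolCode, Nat.pair_eq_pair] at h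
  | func f ts ih =>
    intro t h
    rcases t with (e | j) | ⟨g, us⟩
    · exact e.elim
    · change RingSymbol _ at f
      cases f <;> simp [termCode, symbolCode, Nat.pair_eq_pair] at h
    · change RingSymbol _ at f
      change RingSymbol _ at g
      cases f <;> cases g <;> simp [termCode, symbolCode, Nat.pair_eq_pair] at h
      · congr 1; funext i; fin_cases i
        · exact ih 0 h.1
        · exact ih 1 h.2
      · congr 1; funext i; fin_cases i
        · exact ih 0 h.1
        · exact ih 1 h.2
      · congr 1; funext i; exact i.elim0
      · congr 1; funext i; exact i.elim0

theorem formulaCode_injective {n : ℕ} :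
    Function.Injective (formulaCode : ringLanguage.BoundedFormula Empty n → ℕ) := by
  intro φ
  induction φ with
  | falsum =>
    intro ψ h
    cases ψ with
    | falsum => rfl
    | rel r _ => exact Empty.elim r
    | _ => simp [formulaCode, Nat.pair_eq_pair] at h
  | equal s t =>
    intro ψ h
    cases ψ with
    | equal s' t' =>
      simp only [formulaCode, Nat.pair_eq_pair, true_and] at h
      rw [termCode_injective h.1, termCode_injective h.2]
    | rel r _ => exact Empty.elim r
    | _ => simp [formulaCode, Nat.pair_eq_pair] at h
  | rel r _ => exact Empty.elim r
  | imp φ₁ φ₂ ih₁ ih₂ =>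
    intro ψ h
    cases ψ with
    | imp ψ₁ ψ₂ =>
      simp only [formulaCode, Nat.pair_eq_pair, true_and] at h
      rw [ih₁ h.1, ih₂ h.2]
    | rel r _ => exact Empty.elim r
    | _ => simp [formulaCode, Nat.pair_eq_pair] at h
  | all φ ih =>
    intro ψ h
    cases ψ with
    | all ψ =>
      simp only [formulaCode, Nat.pair_eq_pair, true_and] at h
      rw [ih h]
    | rel r _ => exact Empty.elim r
    | _ => simp [formulaCode, Nat.pair_eq_pair] at h

/-- Distinct sentences have distinct Gödel numbers. -/
theorem godelNumber_injective : Function.Injective godelNumber :=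
  formulaCode_injective

/-- A set of sentences of the language of rings is decidable if some algorithm (partial recursive
function), run on (the Gödel number of) an arbitrary sentence, halts with the output YES if the
sentence belongs to the set and with the output NO otherwise. -/
def DecidableTheory (S : ringLanguage.Theory) : Prop :=
  ∃ f : ℕ →. Bool, Partrec f ∧ ∀ φ : ringLanguage.Sentence,
    (φ ∈ S → true ∈ f (godelNumber φ)) ∧ (φ ∉ S → false ∈ f (godelNumber φ))

end ringLanguage

/-- The field `T` of totally real numbers: the maximal Galois extension of `ℚ` inside `ℝ`. -/
noncomputable def totallyRealNumbers : IntermediateField ℚ ℝ :=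
  sSup {F : IntermediateField ℚ ℝ | IsGalois ℚ F}

/-- `T` is indeed the largest subfield of `ℝ` that is Galois over `ℚ`. -/
theorem totallyRealNumbers_isGreatest :
    IsGreatest {F : IntermediateField ℚ ℝ | IsGalois ℚ F} totallyRealNumbers := by
  refine ⟨?_, fun F hF => le_sSup hF⟩
  have hs : totallyRealNumbers =
      ⨆ F : {F : IntermediateField ℚ ℝ | IsGalois ℚ F}, (F : IntermediateField ℚ ℝ) :=
    sSup_eq_iSup' _
  have hn : Normal ℚ totallyRealNumbers := by
    rw [hs]
    exact @IntermediateField.normal_iSup _ _ _ _ _ _ _ fun F => by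
      have hF : IsGalois ℚ (F : IntermediateField ℚ ℝ) := F.2
      exact hF.to_normal
  exact ⟨⟩

-- The square root of a totally nonnegative element of `𝓞 𝕋` is again totally real and integral, so
-- its totally nonnegative elements are exactly its squares (`exists_sq_eq`). Inequalities holding
-- at all embeddings are therefore first-order (`dominates_iff`).
--
-- The number 4 is a capacity bound. If M < 4, some nonzero integer polynomial f satisfies |f| < 1
-- on [0, M]. If all conjugates of t lie in (0, M), then f(t) has all conjugates of absolute value
-- below 1, hence f(t) = 0, and t is one of finitely many roots. At M = 4 the map t ↦ 2 + √t
-- preserves the interval (0, 4) at every embedding and increases t, so the set has no largest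
-- element.
--
-- Consequently the sets {s | 0 ≪ bs ≪ a} with 0 ≪ b and a ≪ 4b are finite, yet arbitrarily large.
-- This gives a uniformly definable family of finite index sets. Taking residues of one element g
-- modulo 1 + (1 + s)d, in the manner of Gödel's β-function, codes further finite sets. A natural
-- number x is an element at which such a finite set, containing 0, may fail to be closed under
-- adding 1: if x is not natural the set would contain all of ℕ, while for x = n the Chinese
-- remainder theorem produces {0, …, n}.
--
-- Once ℕ is definable, partial recursive functions have definable graphs, and the halting problem
-- reduces to the theory of the ring.

local notation "𝕋" => totallyRealNumbers

/-! ### Conjugates, square roots and small integers in the totally real numbers -/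

namespace TotallyReal

open Polynomial

instance : IsGalois ℚ 𝕋 := totallyRealNumbers_isGreatest.1

/-- The inclusion of the totally real numbers in `ℝ`. -/
noncomputable def incl : 𝕋 →+* ℝ := algebraMap 𝕋 ℝ

theorem splits_map_minpoly (t : 𝕋) : ((minpoly ℚ t).map (algebraMap ℚ ℝ)).Splits := by
  have h := (Normal.splits (F := ℚ) (K := 𝕋) inferInstance t).map (algebraMap 𝕋 ℝ)
  rwa [Polynomial.map_map, ← IsScalarTower.algebraMap_eq] at h

theorem aeval_embedding (σ : 𝕋 →+* ℝ) (t : 𝕋) (p : ℚ[X]) : aeval (σ t) p = σ (aeval t p) :=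
  aeval_algHom_apply σ.toRatAlgHom t p

/-- By normality every conjugate of `t` lies in `𝕋`, and an automorphism of `𝕋` carries `t` to it.
-/
theorem exists_embedding_eq {t : 𝕋} {r : ℝ} (hr : aeval r (minpoly ℚ t) = 0) :
    ∃ σ : 𝕋 →+* ℝ, σ t = r := by
  have hi : IsIntegral ℚ t := (Algebra.IsIntegral.isIntegral t)
  obtain ⟨y, hy⟩ : r ∈ (algebraMap 𝕋 ℝ).range := by
    refine (Normal.splits (F := ℚ) (K := 𝕋) inferInstance t).mem_range_of_isRoot
      ((minpoly.monic hi).map _).ne_zero ?_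
    rw [Polynomial.map_map, ← IsScalarTower.algebraMap_eq, IsRoot.def, eval_map_algebraMap, hr]
  have hy' : aeval y (minpoly ℚ t) = 0 := by
    apply (algebraMap 𝕋 ℝ).injective
    rw [← aeval_algebraMap_apply, hy, hr, map_zero]
  obtain ⟨τ, hτ⟩ := minpoly.exists_algEquiv_of_root hi.isAlgebraic hy'
  exact ⟨incl.comp (τ.symm : 𝕋 →+* 𝕋),
    (congrArg incl (τ.symm_apply_eq.2 hτ.symm)).trans hy⟩

theorem finite_range_embedding (t : 𝕋) : (Set.range fun σ : 𝕋 →+* ℝ => σ t).Finite := by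
  have hi : IsIntegral ℚ t := (Algebra.IsIntegral.isIntegral t)
  refine ((minpoly ℚ t).rootSet_finite ℝ).subset ?_
  rintro _ ⟨σ, rfl⟩
  rw [mem_rootSet]
  exact ⟨(minpoly.monic hi).ne_zero, by rw [aeval_embedding, minpoly.aeval, map_zero]⟩

/-- A totally real number attains its largest conjugate. -/
theorem exists_max_embedding (t : 𝕋) : ∃ σ₀ : 𝕋 →+* ℝ, ∀ σ : 𝕋 →+* ℝ, σ t ≤ σ₀ t := by
  obtain ⟨_, ⟨σ₀, rfl⟩, h⟩ :=
    Set.exists_max_image _ id (finite_range_embedding t) ⟨_, incl, rfl⟩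
  exact ⟨σ₀, fun σ => h _ ⟨σ, rfl⟩⟩

theorem mem_of_splits {p : ℚ[X]} (hp : (p.map (algebraMap ℚ ℝ)).Splits) (h0 : p ≠ 0) {r : ℝ}
    (hr : aeval r p = 0) : r ∈ 𝕋 := by
  have := IntermediateField.adjoin_rootSet_isSplittingField hp
  have hn : Normal ℚ (IntermediateField.adjoin ℚ (p.rootSet ℝ)) := Normal.of_isSplittingField (hFEp := this)
  have hg : IsGalois ℚ (IntermediateField.adjoin ℚ (p.rootSet ℝ)) := ⟨⟩
  exact totallyRealNumbers_isGreatest.2 hg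
    (IntermediateField.subset_adjoin _ _ (mem_rootSet.2 ⟨h0, hr⟩))

/-- If p is the minimal polynomial of `t`, the roots of p(X²) are the numbers ±√σ(t), all real; so
√t lies in a Galois extension of ℚ inside ℝ. -/
theorem exists_sq_eq {t : 𝓞 𝕋} (ht : ∀ σ : 𝕋 →+* ℝ, 0 ≤ σ t) : ∃ x : 𝓞 𝕋, x ^ 2 = t := by
  have hi : IsIntegral ℚ (t : 𝕋) := (Algebra.IsIntegral.isIntegral _)
  set p := minpoly ℚ (t : 𝕋)
  have hpm : p.Monic := minpoly.monic hi
  have hq : ((p.comp (X ^ 2)).map (algebraMap ℚ ℝ)).Splits := by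
    rw [map_comp, (splits_map_minpoly (t : 𝕋)).eq_prod_roots_of_monic (hpm.map _),
      multiset_prod_comp]
    refine Splits.multisetProd ?_
    simp only [Multiset.map_map, Multiset.mem_map, Function.comp_apply, Polynomial.map_pow, map_X,
      sub_comp, X_comp, C_comp]
    rintro _ ⟨r, hr, rfl⟩
    rw [mem_roots ((hpm.map _).ne_zero), IsRoot.def, eval_map_algebraMap] at hr
    obtain ⟨σ, rfl⟩ := exists_embedding_eq hr
    have : (X ^ 2 - C (σ t) : ℝ[X]) = (X - C √(σ t)) * (X - C (-√(σ t))) := by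
      conv_lhs => rw [← Real.sq_sqrt (ht σ)]
      simp only [C_pow, C_neg]; ring
    rw [this]
    exact (Splits.X_sub_C _).mul (Splits.X_sub_C _)
  have h0 : p.comp (X ^ 2) ≠ 0 := (hpm.comp (monic_X_pow 2) (by simp)).ne_zero
  have hsq : √(incl t) ^ 2 = incl t := Real.sq_sqrt (ht _)
  have hr : aeval √(incl t) (p.comp (X ^ 2)) = 0 := by
    rw [aeval_comp, map_pow, aeval_X, hsq, aeval_embedding, minpoly.aeval, map_zero]
  let y : 𝕋 := ⟨√(incl t), mem_of_splits hq h0 hr⟩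
  have hy : y ^ 2 = t := Subtype.ext hsq
  have hyi : IsIntegral ℤ y := IsIntegral.of_pow two_pos (hy ▸ t.2)
  exact ⟨⟨y, hyi⟩, RingOfIntegers.ext hy⟩

/-- Up to sign, the constant coefficient of the integral minimal polynomial is the product of the
conjugates, hence an integer of absolute value below 1. -/
theorem eq_zero_of_abs_embedding_lt_one {q : 𝓞 𝕋} (hq : ∀ σ : 𝕋 →+* ℝ, |σ q| < 1) : q = 0 := by
  have hi : IsIntegral ℤ (q : 𝕋) := q.2
  have hm := minpoly.isIntegrallyClosed_eq_field_fractions' ℚ hi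
  have hs := splits_map_minpoly (q : 𝕋)
  have hpm : (minpoly ℚ (q : 𝕋)).Monic := minpoly.monic (Algebra.IsIntegral.isIntegral _)
  have hc := hs.coeff_zero_eq_prod_roots_of_monic (hpm.map _)
  have hroots : ∀ r ∈ ((minpoly ℚ (q : 𝕋)).map (algebraMap ℚ ℝ)).roots, |r| < 1 := by
    intro r hr
    rw [mem_roots ((hpm.map _).ne_zero), IsRoot.def, eval_map_algebraMap] at hr
    obtain ⟨σ, rfl⟩ := exists_embedding_eq hr
    exact hq σ
  have hcard : 0 < ((minpoly ℚ (q : 𝕋)).map (algebraMap ℚ ℝ)).roots.card := by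
    rw [← hs.natDegree_eq_card_roots, natDegree_map]
    exact minpoly.natDegree_pos (Algebra.IsIntegral.isIntegral _)
  have hprod : ∀ s : Multiset ℝ, (∀ r ∈ s, |r| < 1) → |s.prod| ≤ 1 ∧ (0 < s.card → |s.prod| < 1) := by
    intro s
    induction s using Multiset.induction_on with
    | empty => simp
    | cons a s ih =>
      intro h
      have ha := h a (Multiset.mem_cons_self _ _)
      have hs := (ih fun r hr => h r (Multiset.mem_cons_of_mem hr)).1
      have : |(a ::ₘ s).prod| < 1 := by
        rw [Multiset.prod_cons, abs_mul]
        exact mul_lt_one_of_nonneg_of_lt_one_left (abs_nonneg _) ha hs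
      exact ⟨this.le, fun _ => this⟩
  have h1 := (hprod _ hroots).2 hcard
  have hz : (((minpoly ℤ (q : 𝕋)).coeff 0 : ℤ) : ℝ) =
      ((minpoly ℚ (q : 𝕋)).map (algebraMap ℚ ℝ)).coeff 0 := by
    rw [hm, coeff_map, coeff_map]; simp
  have h2 : (minpoly ℤ (q : 𝕋)).coeff 0 = 0 := by
    rw [← Int.abs_lt_one_iff]
    have : |(((minpoly ℤ (q : 𝕋)).coeff 0 : ℤ) : ℝ)| < 1 := by
      rw [hz, hc, abs_mul, abs_pow, abs_neg, abs_one, one_pow, one_mul]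
      exact h1
    exact_mod_cast this
  refine RingOfIntegers.ext ((minpoly.coeff_zero_eq_zero
    (Algebra.IsIntegral.isIntegral (R := ℚ) (q : 𝕋))).1 ?_)
  rw [hm, coeff_map, h2, map_zero]

end TotallyReal

/-! ### Integer polynomials that are small on short intervals -/

section SmallPolynomial

open Polynomial

/-- The monic Chebyshev polynomials of an interval of length `4ρ`. -/
theorem exists_monic_abs_eval_le {ρ : ℝ} (hρ : 0 < ρ) (j : ℕ) :
    ∃ P : ℝ[X], P.Monic ∧ P.natDegree = j ∧ ∀ x ∈ Set.Icc 0 (4 * ρ), |P.eval x| ≤ 2 * ρ ^ j := by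
  -- Degree 0 is separate: the formula below would give the constant 2, which is not monic.
  rcases Nat.eq_zero_or_pos j with rfl | hj
  · exact ⟨1, monic_one, natDegree_one, fun x _ => by simp⟩
  have hl : ((C (2 * ρ)⁻¹ * X - C 1 : ℝ[X])).leadingCoeff = (2 * ρ)⁻¹ :=
    by rw [sub_eq_add_neg, ← C_neg]; exact leadingCoeff_linear (by positivity)
  have hd : ((C (2 * ρ)⁻¹ * X - C 1 : ℝ[X])).natDegree = 1 :=
    by rw [sub_eq_add_neg, ← C_neg]; exact natDegree_linear (by positivity)
  -- The affine map x ↦ x/(2ρ) - 1 takes [0, 4ρ] onto [-1, 1], and the factor 2ρ^j cancels the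
  -- leading coefficient 2^(j-1)(2ρ)^(-j).
  refine ⟨C (2 * ρ ^ j) * (Chebyshev.T ℝ j).comp (C (2 * ρ)⁻¹ * X - C 1), ?_, ?_, ?_⟩
  · rw [Monic, leadingCoeff_mul, leadingCoeff_C, leadingCoeff_comp (by rw [hd]; simp), hl,
      Chebyshev.leadingCoeff_T, Chebyshev.natDegree_T, Int.natAbs_natCast]
    obtain ⟨k, rfl⟩ := Nat.exists_eq_succ_of_ne_zero hj.ne'
    simp only [Nat.succ_eq_add_one, Nat.add_sub_cancel]
    have h2 : (2 : ℝ) ^ ((k : ℤ) + 1 - 1) = 2 ^ k := by simp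
    simp [pow_succ, mul_pow]
    field_simp
  · rw [natDegree_C_mul (by positivity), natDegree_comp, hd, Chebyshev.natDegree_T]; simp
  · intro x hx
    rw [eval_mul, eval_C, abs_mul, abs_of_pos (by positivity), eval_comp]
    refine mul_le_of_le_one_right (by positivity) (Chebyshev.abs_eval_T_real_le_one _ ?_)
    have h1 : (2 * ρ)⁻¹ * x ≤ 2 := by
      rw [inv_mul_le_iff₀ (by positivity)]; linarith [hx.2]
    have h0 : 0 ≤ (2 * ρ)⁻¹ * x := mul_nonneg (by positivity) hx.1
    simp only [eval_sub, eval_mul, eval_C, eval_X]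
    rw [abs_le]; constructor <;> linarith

/-- Coefficients are rounded up from the top degree downwards: adding a multiple in [0, 1] of the
monic `P j` makes the coefficient of X^j an integer and disturbs only lower ones. -/
theorem exists_int_polynomial_eq_add_sum {P : ℕ → ℝ[X]} (hP : ∀ j, (P j).Monic)
    (hd : ∀ j, (P j).natDegree = j) (n : ℕ) (g : ℝ[X]) (hg : g.degree < n) :
    ∃ (h : ℤ[X]) (c : ℕ → ℝ), h.degree < n ∧ (∀ j, c j ∈ Set.Icc 0 1) ∧
      h.map (Int.castRingHom ℝ) = g + ∑ j ∈ Finset.range n, C (c j) * P j := by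
  induction n generalizing g with
  | zero =>
    refine ⟨0, 0, by simp, fun j => by simp, ?_⟩
    have : g = 0 := by simpa using hg
    simp [this]
  | succ n ih =>
    set a := g.coeff n
    have hlt : (g + C (⌈a⌉ - a) * P n - C (⌈a⌉ : ℝ) * X ^ n).degree < (n : WithBot ℕ) := by
      rw [degree_lt_iff_coeff_zero]
      intro m hm
      rcases hm.eq_or_lt with rfl | hm
      · have := hP n
        rw [Monic, leadingCoeff, hd] at this
        simp only [coeff_sub, coeff_add, coeff_C_mul, coeff_X_pow, this, if_true]
        ring
      · have h1 : g.coeff m = 0 := by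
          rw [degree_lt_iff_coeff_zero] at hg
          exact hg m hm
        have h2 : (P n).coeff m = 0 := coeff_eq_zero_of_natDegree_lt (by rwa [hd])
        simp only [coeff_sub, coeff_add, coeff_C_mul, h1, h2, coeff_X_pow, hm.ne', if_false]
        simp
    obtain ⟨h, c, hh, hc, he⟩ := ih _ hlt
    refine ⟨h + C ⌈a⌉ * X ^ n, Function.update c n (⌈a⌉ - a), ?_, ?_, ?_⟩
    · refine (degree_add_le _ _).trans_lt (max_lt (hh.trans (by exact_mod_cast n.lt_succ_self)) ?_)
      exact (degree_C_mul_X_pow_le _ _).trans_lt (by exact_mod_cast n.lt_succ_self)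
    · intro j
      rcases eq_or_ne j n with rfl | hj
      · rw [Function.update_self]
        exact ⟨by linarith [Int.le_ceil a], by linarith [Int.ceil_lt_add_one a]⟩
      · rw [Function.update_of_ne hj]; exact hc j
    · rw [Finset.sum_range_succ, Function.update_self, Polynomial.map_add, he]
      have : ∑ j ∈ Finset.range n, C (Function.update c n (⌈a⌉ - a) j) * P j =
          ∑ j ∈ Finset.range n, C (c j) * P j :=
        Finset.sum_congr rfl fun j hj => by
          rw [Function.update_of_ne (Finset.mem_range.1 hj).ne]
      rw [this]
      rw [Polynomial.map_mul, Polynomial.map_pow, map_X, map_C, eq_intCast]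
      ring

/-- An interval of length less than `4` carries a nonzero integer polynomial that is everywhere
less than `1` in absolute value. -/
theorem exists_int_polynomial_abs_lt_one {M : ℝ} (hM : M < 4) :
    ∃ f : ℤ[X], f ≠ 0 ∧ ∀ x ∈ Set.Icc 0 M, |f.aeval x| < 1 := by
  -- The bound 1/2 only keeps ρ positive when M is small or negative.
  obtain ⟨ρ, hρ0, hρ1, hMρ⟩ : ∃ ρ : ℝ, 0 < ρ ∧ ρ < 1 ∧ M ≤ 4 * ρ :=
    ⟨max (1 / 2) (M / 4), by positivity, max_lt (by norm_num) (by linarith),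
      by linarith [le_max_right (1 / 2) (M / 4)]⟩
  choose P hP hd hb using fun j => exists_monic_abs_eval_le hρ0 j
  have key : ∀ k, ∃ (F : ℤ[X]) (c : ℕ → ℝ), F.natDegree = k ∧ (∀ j, c j ∈ Set.Icc 0 1) ∧
      F.map (Int.castRingHom ℝ) = P k + ∑ j ∈ Finset.range k, C (c j) * P j := by
    intro k
    have hlt : (P k - X ^ k).degree < (k : WithBot ℕ) := by
      have := degree_sub_lt_left (p := P k) (q := X ^ k)
        (by rw [degree_eq_natDegree (hP k).ne_zero, hd, degree_X_pow]) (hP k).ne_zero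
        (by rw [(hP k).leadingCoeff, leadingCoeff_X_pow])
      rwa [degree_eq_natDegree (hP k).ne_zero, hd] at this
    obtain ⟨h, c, hh, hc, he⟩ := exists_int_polynomial_eq_add_sum hP hd k _ hlt
    refine ⟨X ^ k + h, c, ?_, hc, ?_⟩
    · rw [natDegree_add_eq_left_of_degree_lt (by rwa [degree_X_pow]), natDegree_X_pow]
    · rw [Polynomial.map_add, he, Polynomial.map_pow, map_X]; ring
  choose F c hF hc he using key
  -- J makes each geometric tail 2ρ^J/(1 - ρ) at most 1/4; K makes the J low terms, each at most
  -- 2/K, contribute at most 1/4. The difference of two such polynomials is then at most 3/4.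
  obtain ⟨J, hJ⟩ : ∃ J : ℕ, ρ ^ J < (1 - ρ) / 8 :=
    exists_pow_lt_of_lt_one (by linarith) hρ1
  obtain ⟨K, hK⟩ : ∃ K : ℕ, 8 * (J : ℝ) < K := exists_nat_gt _
  have hK0 : (0 : ℝ) < K := lt_of_le_of_lt (by positivity) hK
  -- two of the `F k` have nearly the same coefficients below `J`
  let code : ℕ → Fin J → Fin (K + 1) := fun k j =>
    ⟨⌊K * c (J + k) j⌋₊, Nat.lt_succ_of_le (Nat.floor_le_of_le
      (mul_le_of_le_one_right hK0.le (hc _ _).2))⟩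
  obtain ⟨k, l, hkl, hcode⟩ := Finite.exists_ne_map_eq_of_infinite code
  have hclose : ∀ j < J, |c (J + k) j - c (J + l) j| ≤ 1 / K := by
    intro j hj
    have h1 : ⌊K * c (J + k) j⌋₊ = ⌊K * c (J + l) j⌋₊ :=
      congrArg Fin.val (congrFun hcode ⟨j, hj⟩)
    have h2 := Nat.floor_le (mul_nonneg hK0.le (hc (J + k) j).1)
    have h3 := Nat.floor_le (mul_nonneg hK0.le (hc (J + l) j).1)
    have h4 := Nat.lt_floor_add_one (K * c (J + k) j)
    have h5 := Nat.lt_floor_add_one (K * c (J + l) j)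
    rw [h1] at h2 h4
    rw [abs_le, ← neg_div, div_le_iff₀ hK0, le_div_iff₀ hK0]
    constructor <;> linarith
  -- the part of `F k` above `J` is small
  have htail : ∀ m, ∀ x ∈ Set.Icc 0 (4 * ρ),
      |(P (J + m)).eval x + ∑ i ∈ Finset.range m, c (J + m) (J + i) * (P (J + i)).eval x|
        ≤ 1 / 4 := by
    intro m x hx
    have hle : |(P (J + m)).eval x + ∑ i ∈ Finset.range m, c (J + m) (J + i) * (P (J + i)).eval x|
        ≤ ∑ i ∈ Finset.range (m + 1), 2 * ρ ^ J * ρ ^ i := by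
      rw [Finset.sum_range_succ, add_comm]
      refine (abs_add_le _ _).trans (add_le_add ((Finset.abs_sum_le_sum_abs _ _).trans
        (Finset.sum_le_sum fun i _ => ?_)) ?_)
      · rw [abs_mul, abs_of_nonneg (hc _ _).1, mul_assoc, ← pow_add]
        exact (mul_le_of_le_one_left (abs_nonneg _) (hc _ _).2).trans (hb _ x hx)
      · rw [mul_assoc, ← pow_add]; exact hb _ x hx
    rw [← Finset.mul_sum] at hle
    have hg : ∑ i ∈ Finset.range (m + 1), ρ ^ i ≤ (1 - ρ)⁻¹ := by
      rw [← tsum_geometric_of_lt_one hρ0.le hρ1]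
      exact (summable_geometric_of_lt_one hρ0.le hρ1).sum_le_tsum _ fun i _ => by positivity
    refine hle.trans ((mul_le_mul_of_nonneg_left hg (by positivity)).trans ?_)
    rw [← div_eq_mul_inv, div_le_iff₀ (by linarith)]
    linarith
  have heval : ∀ m x, (F (J + m)).aeval x = (∑ j ∈ Finset.range J, c (J + m) j * (P j).eval x) +
      ((P (J + m)).eval x + ∑ i ∈ Finset.range m, c (J + m) (J + i) * (P (J + i)).eval x) := by
    intro m x
    have := congrArg (eval x) (he (J + m))
    rw [eval_map, Finset.sum_range_add] at this
    rw [aeval_def, algebraMap_int_eq, this]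
    simp only [eval_add, eval_finsetSum, eval_mul, eval_C]
    ring
  refine ⟨F (J + k) - F (J + l), fun h => hkl ?_, fun x hx => ?_⟩
  · have := congrArg natDegree (sub_eq_zero.1 h)
    rw [hF, hF] at this
    exact Nat.add_left_cancel this
  · have hx' : x ∈ Set.Icc 0 (4 * ρ) := ⟨hx.1, hx.2.trans hMρ⟩
    have hlow : |(∑ j ∈ Finset.range J, c (J + k) j * (P j).eval x) -
        ∑ j ∈ Finset.range J, c (J + l) j * (P j).eval x| ≤ 1 / 4 := by
      rw [← Finset.sum_sub_distrib]
      refine (Finset.abs_sum_le_sum_abs _ _).trans ((Finset.sum_le_card_nsmul (Finset.range J) _ (1 / (K : ℝ) * 2)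
        fun j hj => ?_).trans ?_)
      · rw [← sub_mul, abs_mul]
        refine mul_le_mul (hclose j (Finset.mem_range.1 hj)) ((hb j x hx').trans ?_)
          (abs_nonneg _) (by positivity)
        have := pow_le_one₀ (n := j) hρ0.le hρ1.le
        linarith
      · rw [Finset.card_range, nsmul_eq_mul]
        field_simp
        linarith
    rw [map_sub, heval, heval]
    have h1 := abs_le.1 (htail k x hx')
    have h2 := abs_le.1 (htail l x hx')
    have h3 := abs_le.1 hlow
    rw [abs_lt]
    constructor <;> linarith [h1.1, h1.2, h2.1, h2.2, h3.1, h3.2]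

end SmallPolynomial

/-! ### The least bound is 4 -/

namespace TotallyReal

open Polynomial

theorem finite_of_lt_four {M : ℝ} (hM : M < 4) :
    {t : 𝓞 𝕋 | ∀ σ : 𝕋 →+* ℝ, 0 < σ t ∧ σ t < M}.Finite := by
  obtain ⟨f, hf0, hf⟩ := exists_int_polynomial_abs_lt_one hM
  refine (f.rootSet_finite (𝓞 𝕋)).subset fun t ht => ?_
  rw [mem_rootSet]
  refine ⟨hf0, eq_zero_of_abs_embedding_lt_one fun σ => ?_⟩
  have : σ ((aeval t f : 𝓞 𝕋) : 𝕋) = aeval (σ t) f := by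
    change (σ.comp (algebraMap (𝓞 𝕋) 𝕋)) (aeval t f) = _
    exact (aeval_algHom_apply (σ.comp (algebraMap (𝓞 𝕋) 𝕋)).toIntAlgHom t f).symm
  rw [this]
  exact hf _ ⟨(ht σ).1.le, (ht σ).2.le⟩

theorem infinite_four : {t : 𝓞 𝕋 | ∀ σ : 𝕋 →+* ℝ, 0 < σ t ∧ σ t < 4}.Infinite := by
  intro hfin
  obtain ⟨t, ht, hmax⟩ := Set.exists_max_image _ (fun t : 𝓞 𝕋 => incl t) hfin
    ⟨1, fun σ => by simp⟩
  obtain ⟨x, hx⟩ := exists_sq_eq fun σ => (ht σ).1.le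
  wlog hx0 : 0 ≤ incl x generalizing x
  · exact this (-x) (by rw [neg_sq, hx]) (by simp at hx0 ⊢; linarith)
  have hsq : ∀ σ : 𝕋 →+* ℝ, σ x ^ 2 = σ t := fun σ => by rw [← hx]; simp
  -- With 0 ≤ x < 2 at the inclusion, 2 + x > x² = t, which contradicts the maximality of t.
  have h := hmax (2 + x) fun σ => by
    have h0 := hsq σ
    have h1 := ht σ
    have h2 : |σ x| < 2 := abs_lt_of_sq_lt_sq (by linarith) (by norm_num)
    rw [abs_lt] at h2
    simp only [map_add, map_ofNat]
    constructor <;> linarith [h2.1, h2.2]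
  have h0 := hsq incl
  have h1 := ht incl
  have h2 : incl x < 2 := lt_of_pow_lt_pow_left₀ 2 (by norm_num) (by linarith)
  simp only [map_add, map_ofNat] at h
  nlinarith

theorem isLeast_four : IsLeast {M : ℝ | {t : 𝓞 𝕋 | ∀ σ : 𝕋 →+* ℝ,
    0 < σ (t : 𝕋) ∧ σ (t : 𝕋) < M}.Infinite} 4 :=
  ⟨infinite_four, fun _ hM => not_lt.1 fun h => hM (finite_of_lt_four h)⟩

end TotallyReal

/-! ### Closure properties of definable predicates -/

namespace ringLanguage

section Definability

variable {R : Type*} [CommRing R] {α β : Type}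

/-- A function on tuples that is given by a term of the language of rings. -/
def IsTermFun (f : (α → R) → R) : Prop :=
  ∃ t : ringLanguage.Term α, ∀ v, t.realize v = f v

/-- A predicate on tuples that is given by a formula of the language of rings. -/
def IsDef (P : (α → R) → Prop) : Prop :=
  ∃ φ : ringLanguage.Formula α, ∀ v, φ.Realize v ↔ P v

namespace IsTermFun

variable {f g : (α → R) → R}

theorem var (a : α) : IsTermFun fun v : α → R => v a := ⟨.var a, fun _ => rfl⟩

theorem zero : IsTermFun fun _ : α → R => 0 :=
  ⟨.func (l := 0) RingSymbol.zero Fin.elim0, fun _ => rfl⟩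

theorem one : IsTermFun fun _ : α → R => 1 :=
  ⟨.func (l := 0) RingSymbol.one Fin.elim0, fun _ => rfl⟩

theorem add (hf : IsTermFun f) (hg : IsTermFun g) : IsTermFun fun v => f v + g v := by
  obtain ⟨s, hs⟩ := hf
  obtain ⟨t, ht⟩ := hg
  exact ⟨.func (l := 2) RingSymbol.add ![s, t], fun v => congrArg₂ (· + ·) (hs v) (ht v)⟩

theorem mul (hf : IsTermFun f) (hg : IsTermFun g) : IsTermFun fun v => f v * g v := by
  obtain ⟨s, hs⟩ := hf
  obtain ⟨t, ht⟩ := hg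
  exact ⟨.func (l := 2) RingSymbol.mul ![s, t], fun v => congrArg₂ (· * ·) (hs v) (ht v)⟩

theorem natCast (n : ℕ) : IsTermFun fun _ : α → R => (n : R) := by
  induction n with
  | zero => simpa using zero
  | succ n ih => simpa using ih.add one

theorem reindex (hf : IsTermFun f) (e : α → β) : IsTermFun fun v : β → R => f fun a => v (e a) := by
  obtain ⟨t, ht⟩ := hf
  exact ⟨t.relabel e, fun v => Language.Term.realize_relabel.trans (ht _)⟩

end IsTermFun

namespace IsDef

variable {P Q : (α → R) → Prop}

theorem eq {f g : (α → R) → R} (hf : IsTermFun f) (hg : IsTermFun g) :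
    IsDef fun v => f v = g v := by
  obtain ⟨s, hs⟩ := hf
  obtain ⟨t, ht⟩ := hg
  exact ⟨s.equal t, fun v => by rw [Language.Formula.realize_equal, hs, ht]⟩

theorem not (hP : IsDef P) : IsDef fun v => ¬ P v := by
  obtain ⟨φ, hφ⟩ := hP
  exact ⟨φ.not, fun v => by rw [Language.Formula.realize_not, hφ]⟩

theorem and (hP : IsDef P) (hQ : IsDef Q) : IsDef fun v => P v ∧ Q v := by
  obtain ⟨φ, hφ⟩ := hP
  obtain ⟨ψ, hψ⟩ := hQ
  exact ⟨φ ⊓ ψ, fun v => by rw [Language.Formula.realize_inf, hφ, hψ]⟩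

theorem congr (hP : IsDef P) (h : ∀ v, P v ↔ Q v) : IsDef Q := by
  obtain ⟨φ, hφ⟩ := hP
  exact ⟨φ, fun v => (hφ v).trans (h v)⟩

theorem or (hP : IsDef P) (hQ : IsDef Q) : IsDef fun v => P v ∨ Q v :=
  (hP.not.and hQ.not).not.congr fun v => by tauto

theorem imp (hP : IsDef P) (hQ : IsDef Q) : IsDef fun v => P v → Q v :=
  (hP.not.or hQ).congr fun v => by tauto

theorem reindex (hP : IsDef P) (e : α → β) : IsDef fun v : β → R => P fun a => v (e a) := by
  obtain ⟨φ, hφ⟩ := hP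
  exact ⟨φ.relabel e, fun v => Language.Formula.realize_relabel.trans (hφ _)⟩

/-- The bound variable is the index `none`; the remaining variables are the `some a`. -/
theorem ex {P : (α → R) → R → Prop}
    (hP : IsDef fun w : Option α → R => P (fun a => w (some a)) (w none)) :
    IsDef fun v => ∃ x, P v x := by
  obtain ⟨φ, hφ⟩ := hP
  refine ⟨Language.Formula.iExs Unit (φ.relabel fun o => o.elim (Sum.inr ()) Sum.inl), fun v => ?_⟩
  rw [Language.Formula.realize_iExs]
  constructor
  · rintro ⟨i, hi⟩
    exact ⟨i (), (hφ _).1 (Language.Formula.realize_relabel.1 hi)⟩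
  · rintro ⟨x, hx⟩
    exact ⟨fun _ => x, Language.Formula.realize_relabel.2 ((hφ _).2 hx)⟩

theorem all {P : (α → R) → R → Prop}
    (hP : IsDef fun w : Option α → R => P (fun a => w (some a)) (w none)) :
    IsDef fun v => ∀ x, P v x :=
  (ex (P := fun v x => ¬ P v x) hP.not).not.congr fun v => by simp

/-- Substitution of terms in a definable predicate. -/
theorem subst₁ {P : R → Prop} (hP : IsDef fun v : Unit → R => P (v ())) {f : (α → R) → R}
    (hf : IsTermFun f) : IsDef fun v => P (f v) :=
  (ex (P := fun v x => x = f v ∧ P x)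
    ((eq (.var none) (hf.reindex some)).and (hP.reindex fun _ => none))).congr fun v => by simp

theorem definable₁ {s : Set R} (hs : IsDef fun v : Unit → R => v () ∈ s) :
    (∅ : Set R).Definable₁ ringLanguage s := by
  obtain ⟨φ, hφ⟩ := hs.reindex fun _ => (0 : Fin 1)
  exact Set.empty_definable_iff.2 ⟨φ, Set.ext fun v => (hφ v).symm⟩

end IsDef

end Definability

end ringLanguage

/-! ### Defining the natural numbers in the ring of integers -/

namespace TotallyReal

open ringLanguage

section Ring

variable {R : Type*} [CommRing R]

/-- The difference is a nonzero square: in `𝓞 𝕋` this is strict inequality at all embeddings. -/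
def Dominates (u v : R) : Prop := ∃ z : R, ¬ z = 0 ∧ u = v + z * z

/-- The set of the `s` such that `0 ≪ b s ≪ a`. -/
def InBox (a b s : R) : Prop := Dominates (b * s) 0 ∧ Dominates a (b * s)

/-- The values between `0` and `B` of `g` modulo the numbers `1 + (1 + s) d`, where
`0 ≪ b s ≪ a`. -/
def IsResidue (a b d g B v : R) : Prop :=
  ∃ s, InBox a b s ∧ (∃ z, v = z * z) ∧ (∃ z, B = v + z * z) ∧ ∃ q, g = v + q * (1 + (1 + s) * d)

/-- The predicate that defines the natural numbers. -/
def IsNatural (x : R) : Prop :=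
  ∃ a b d g B : R, Dominates b 0 ∧ Dominates ((4 : ℕ) * b) a ∧
    (∀ s, InBox a b s → Dominates (1 + (1 + s) * d) B) ∧
    IsResidue a b d g B 0 ∧ ∀ v, IsResidue a b d g B v → v = x ∨ IsResidue a b d g B (v + 1)

variable {α : Type} {a b d g B f : (α → R) → R}

theorem isDef_dominates (ha : IsTermFun a) (hb : IsTermFun b) :
    IsDef fun v => Dominates (a v) (b v) :=
  .ex (.and (.not (.eq (.var _) .zero))
    (.eq (ha.reindex _) (.add (hb.reindex _) (.mul (.var _) (.var _)))))

theorem isDef_inBox (ha : IsTermFun a) (hb : IsTermFun b) (hf : IsTermFun f) :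
    IsDef fun v => InBox (a v) (b v) (f v) :=
  .and (isDef_dominates (.mul hb hf) .zero) (isDef_dominates ha (.mul hb hf))

theorem isDef_isResidue (ha : IsTermFun a) (hb : IsTermFun b) (hd : IsTermFun d) (hg : IsTermFun g)
    (hB : IsTermFun B) (hf : IsTermFun f) :
    IsDef fun v => IsResidue (a v) (b v) (d v) (g v) (B v) (f v) :=
  .ex (.and (isDef_inBox (ha.reindex _) (hb.reindex _) (.var _))
    (.and (.ex (.eq ((hf.reindex _).reindex _) (.mul (.var _) (.var _))))
    (.and (.ex (.eq ((hB.reindex _).reindex _)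
      (.add ((hf.reindex _).reindex _) (.mul (.var _) (.var _)))))
    (.ex (.eq ((hg.reindex _).reindex _) (.add ((hf.reindex _).reindex _)
      (.mul (.var _) (.add .one (.mul (.add .one (.var _)) ((hd.reindex _).reindex _))))))))))

theorem isDef_isNatural : IsDef fun v : Unit → R => IsNatural (v ()) :=
  .ex (.ex (.ex (.ex (.ex (.and (isDef_dominates (.var _) .zero)
    (.and (isDef_dominates (.mul (.natCast 4) (.var _)) (.var _))
    (.and (.all (.imp (isDef_inBox (.var _) (.var _) (.var _))
      (isDef_dominates (.add .one (.mul (.add .one (.var _)) (.var _))) (.var _))))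
    (.and (isDef_isResidue (.var _) (.var _) (.var _) (.var _) (.var _) .zero)
    (.all (.imp (isDef_isResidue (.var _) (.var _) (.var _) (.var _) (.var _) (.var _))
      (.or (.eq (.var _) (.var _))
        (isDef_isResidue (.var _) (.var _) (.var _) (.var _) (.var _)
          (.add (.var _) .one)))))))))))))

end Ring

theorem exists_mul_self_iff {v : 𝓞 𝕋} : (∃ z, v = z * z) ↔ ∀ σ : 𝕋 →+* ℝ, 0 ≤ σ v := by
  constructor
  · rintro ⟨z, rfl⟩ σ
    simpa using mul_self_nonneg (σ z)
  · intro h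
    obtain ⟨z, hz⟩ := exists_sq_eq h
    exact ⟨z, by rw [← hz, sq]⟩

theorem exists_add_mul_self_iff {u v : 𝓞 𝕋} :
    (∃ z, u = v + z * z) ↔ ∀ σ : 𝕋 →+* ℝ, σ v ≤ σ u := by
  have : (∃ z, u = v + z * z) ↔ ∃ z, u - v = z * z :=
    exists_congr fun z => by rw [sub_eq_iff_eq_add']
  rw [this, exists_mul_self_iff]
  simp

theorem dominates_iff {u v : 𝓞 𝕋} : Dominates u v ↔ ∀ σ : 𝕋 →+* ℝ, σ v < σ u := by
  constructor
  · rintro ⟨z, hz, rfl⟩ σ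
    have : σ z ≠ 0 := by simpa using hz
    simpa using mul_self_pos.2 this
  · intro h
    obtain ⟨z, hz⟩ := exists_add_mul_self_iff.2 fun σ => (h σ).le
    refine ⟨z, fun h0 => ?_, hz⟩
    have := h incl
    simp [hz, h0] at this

theorem inBox_iff {a b s : 𝓞 𝕋} :
    InBox a b s ↔ ∀ σ : 𝕋 →+* ℝ, 0 < σ b * σ s ∧ σ b * σ s < σ a := by
  simp only [InBox, dominates_iff, forall_and]
  simp

/-- The quotient a/b attains its largest conjugate, which is below 4 and so bounds all conjugates of
all `s` at once. -/
theorem finite_inBox {a b : 𝓞 𝕋} (hb : Dominates b 0) (hab : Dominates ((4 : ℕ) * b) a) :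
    {s | InBox a b s}.Finite := by
  rw [dominates_iff] at hb hab
  obtain ⟨σ₀, hσ₀⟩ := exists_max_embedding ((a : 𝕋) / b)
  simp only [map_div₀] at hσ₀
  simp only [map_zero, map_mul, map_natCast] at hb hab
  refine (finite_of_lt_four (M := σ₀ a / σ₀ b) ?_).subset fun s hs σ => ?_
  · rw [div_lt_iff₀ (hb σ₀)]
    exact_mod_cast hab σ₀
  · have h := inBox_iff.1 hs σ
    refine ⟨pos_of_mul_pos_right h.1 (hb σ).le, lt_of_lt_of_le ?_ (hσ₀ σ)⟩
    rw [lt_div_iff₀ (hb σ), mul_comm]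
    exact h.2

/-- At each embedding |u - v| ≤ B < m, so all conjugates of q are below 1 in absolute value and q =
0. Hence a residue between 0 and `B` is unique. -/
theorem eq_of_sub_eq_mul {u v q m B : 𝓞 𝕋} (hu : ∃ z, u = z * z) (hu' : ∃ z, B = u + z * z)
    (hv : ∃ z, v = z * z) (hv' : ∃ z, B = v + z * z) (hm : Dominates m B) (h : u - v = q * m) :
    u = v := by
  rw [exists_mul_self_iff] at hu hv
  rw [exists_add_mul_self_iff] at hu' hv'
  rw [dominates_iff] at hm
  have hq : q = 0 := by
    refine eq_zero_of_abs_embedding_lt_one fun σ => ?_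
    have h1 : σ u - σ v = σ q * σ m := by simpa using congrArg (fun x : 𝓞 𝕋 => σ x) h
    have h2 : |σ u - σ v| < σ m := by
      rw [abs_lt]; constructor <;> linarith [hu σ, hv σ, hu' σ, hv' σ, hm σ]
    have hm0 : 0 < σ m := (abs_nonneg _).trans_lt h2
    rw [h1, abs_mul, abs_of_pos hm0] at h2
    exact lt_of_mul_lt_mul_right (by rwa [one_mul]) hm0.le
  rw [hq, zero_mul] at h
  exact sub_eq_zero.1 h

theorem finite_isResidue {a b d g B : 𝓞 𝕋} (hb : Dominates b 0)
    (hab : Dominates ((4 : ℕ) * b) a) (hd : ∀ s, InBox a b s → Dominates (1 + (1 + s) * d) B) :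
    {v | IsResidue a b d g B v}.Finite := by
  refine ((finite_inBox hb hab).biUnion (t := fun s => {v | InBox a b s ∧ (∃ z, v = z * z) ∧
    (∃ z, B = v + z * z) ∧ ∃ q, g = v + q * (1 + (1 + s) * d)}) fun s hs => ?_).subset ?_
  · refine Set.Subsingleton.finite ?_
    rintro u ⟨-, hu, hu', q, hq⟩ v ⟨-, hv, hv', r, hr⟩
    exact eq_of_sub_eq_mul hu hu' hv hv' (hd s hs) (q := r - q) (by linear_combination hr - hq)
  · rintro v ⟨s, hs, hv⟩
    exact Set.mem_biUnion hs ⟨hs, hv⟩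

theorem mem_range_natCast_of_isNatural {x : 𝓞 𝕋} (hx : IsNatural x) :
    x ∈ Set.range (Nat.cast : ℕ → 𝓞 𝕋) := by
  obtain ⟨a, b, d, g, B, hb, hab, hd, h0, hs⟩ := hx
  by_contra hx
  have h : ∀ n : ℕ, IsResidue a b d g B n := by
    intro n
    induction n with
    | zero => simpa using h0
    | succ n ih =>
      rcases hs _ ih with h | h
      · exact (hx ⟨n, h⟩).elim
      · simpa using h
  exact Set.infinite_of_injective_forall_mem (Nat.cast_injective (R := 𝓞 𝕋)) h
    (finite_isResidue hb hab hd)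

theorem exists_natCast_eq_mul (w : 𝓞 𝕋) : ∃ m : ℕ, m ≠ 0 ∧ (w ≠ 0 → w ∣ m) := by
  by_cases hw : w = 0
  · exact ⟨1, one_ne_zero, fun h => (h hw).elim⟩
  have hw' : (w : 𝕋) ≠ 0 := by simpa using hw
  have hi : IsIntegral ℤ (w : 𝕋) := w.2
  obtain ⟨y, hy0, hy⟩ := IsAlgebraic.exists_integral_multiple hi.isAlgebraic.inv
  refine ⟨y.natAbs, by simpa using hy0, fun _ => ?_⟩
  have h : w ∣ (y : 𝓞 𝕋) := by
    refine ⟨⟨_, hy⟩, RingOfIntegers.ext ?_⟩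
    change ((y : 𝓞 𝕋) : 𝕋) = w * (y • (w : 𝕋)⁻¹)
    rw [zsmul_eq_mul, mul_left_comm, mul_inv_cancel₀ hw', mul_one]
    rfl
  rcases Int.natAbs_eq y with h' | h' <;> rw [h'] at h <;> simpa using h

/-- There are large finite sets of the form `{s | 0 ≪ b s ≪ a}`. -/
theorem exists_inBox_injective (n : ℕ) : ∃ (a b : 𝓞 𝕋) (f : Fin n → 𝓞 𝕋), Dominates b 0 ∧
    Dominates ((4 : ℕ) * b) a ∧ f.Injective ∧ ∀ i, InBox a b (f i) := by
  let e := infinite_four.natEmbedding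
  choose σ₀ hσ₀ using fun i => exists_max_embedding ((e i : 𝓞 𝕋) : 𝕋)
  obtain ⟨M, hM4, hM⟩ : ∃ M : ℝ, M < 4 ∧ ∀ i < n, σ₀ i (e i : 𝓞 𝕋) < M := by
    clear * -
    induction n with
    | zero => exact ⟨0, by norm_num, by simp⟩
    | succ n ih =>
      obtain ⟨M, hM4, hM⟩ := ih
      obtain ⟨M', h1, h2⟩ := exists_between (max_lt hM4 ((e n).2 (σ₀ n)).2)
      refine ⟨M', h2, fun i hi => ?_⟩
      rcases Nat.lt_succ_iff_lt_or_eq.1 hi with hi | rfl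
      · exact (hM i hi).trans ((le_max_left _ _).trans_lt h1)
      · exact (le_max_right _ _).trans_lt h1
  -- The numerator and denominator of a rational r with max(M, 0) < r < 4 serve as `a` and `b`.
  obtain ⟨r, hr, hr4⟩ := exists_rat_btwn (max_lt hM4 (show (0 : ℝ) < 4 by norm_num))
  have hr0 : 0 < r := by exact_mod_cast (le_max_right _ _).trans_lt hr
  have hden : (0 : ℝ) < r.den := by exact_mod_cast r.den_pos
  have hrn : (r.den : ℝ) * r = r.num.toNat := by
    have : ((r.num.toNat : ℤ) : ℝ) = r.num := by rw [Int.toNat_of_nonneg (Rat.num_pos.2 hr0).le]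
    rw [← Int.cast_natCast r.num.toNat, this]
    exact_mod_cast Rat.den_mul_eq_num r
  refine ⟨r.num.toNat, r.den, fun i => e i, ?_, ?_, fun i j h => Fin.ext ?_, fun i => ?_⟩
  · rw [dominates_iff]; simpa using fun _ => r.den_pos
  · rw [dominates_iff]; intro σ
    simp only [map_natCast, map_mul, ← hrn]
    push_cast
    nlinarith
  · exact e.injective (Subtype.ext h)
  · rw [inBox_iff]; intro σ
    simp only [map_natCast, ← hrn]
    have h1 := ((e i).2 σ).1
    have h2 := (hσ₀ i σ).trans_lt ((hM i i.2).trans ((le_max_left _ _).trans_lt hr))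
    exact ⟨mul_pos hden h1, mul_lt_mul_of_pos_left h2 hden⟩

theorem isNatural_natCast (n : ℕ) : IsNatural (n : 𝓞 𝕋) := by
  obtain ⟨a, b, f, hb, hab, hf, hfb⟩ := exists_inBox_injective (n + 1)
  have hfin := finite_inBox hb hab
  choose m hm0 hm using exists_natCast_eq_mul
  -- The product is divisible by every nonzero difference of box elements, which gives coprime
  -- moduli; diagonal factors are merely nonzero. The factor n + 1 forces n < d.
  let d : ℕ := (n + 1) * ∏ p ∈ hfin.toFinset ×ˢ hfin.toFinset, m (p.1 - p.2)
  have hnd : n < d := Nat.lt_of_succ_le (Nat.le_mul_of_pos_right _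
    (Finset.prod_pos fun p _ => Nat.pos_of_ne_zero (hm0 _)))
  have hdvd : ∀ s s', InBox a b s → InBox a b s' → s ≠ s' → (s - s') ∣ (d : 𝓞 𝕋) := by
    intro s s' hs hs' hne
    refine (hm _ (sub_ne_zero.2 hne)).trans (Nat.cast_dvd_cast (Dvd.dvd.mul_left ?_ _))
    exact Finset.dvd_prod_of_mem (fun p : 𝓞 𝕋 × 𝓞 𝕋 => m (p.1 - p.2)) (a := (s, s'))
      (by simpa using ⟨hs, hs'⟩)
  -- Conjugates of s may be close to 0; the summand 1 in 1 + s keeps the modulus above d.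
  have hdom : ∀ s, InBox a b s → Dominates (1 + (1 + s) * (d : 𝓞 𝕋)) n := by
    intro s hs
    rw [dominates_iff] at hb ⊢
    rw [inBox_iff] at hs
    intro σ
    have h1 : 0 < σ s := by
      have := hb σ
      simp only [map_zero] at this
      exact pos_of_mul_pos_right (hs σ).1 this.le
    have h2 : (n : ℝ) < d := by exact_mod_cast hnd
    simp only [map_add, map_one, map_mul, map_natCast]
    nlinarith [Nat.cast_nonneg (α := ℝ) d]
  -- Box elements outside the range of `f` get an arbitrary value, harmless because it is still at
  -- most n.
  let val : 𝓞 𝕋 → Fin (n + 1) := Function.invFun f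
  have hval : ∀ i, val (f i) = i := Function.leftInverse_invFun hf
  have : Finite {s | InBox a b s} := hfin
  obtain ⟨g, hg⟩ := Ideal.exists_forall_sub_mem_ideal
    (I := fun s : {s | InBox a b s} => Ideal.span {1 + (1 + (s : 𝓞 𝕋)) * (d : 𝓞 𝕋)})
    (by
      rintro ⟨s, hs⟩ ⟨s', hs'⟩ hne
      obtain ⟨k, hk⟩ := hdvd s s' hs hs' fun h => hne (Subtype.ext h)
      rw [Function.onFun, Ideal.isCoprime_span_singleton_iff]
      -- Write m, m' for the moduli of s, s'. Then (1 + s)m' - (1 + s')m = s - s'; multiplying by k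
      -- gives d, and 1 = m - (1 + s)d.
      refine ⟨1 + (1 + s) * k * (1 + s'), -((1 + s) ^ 2 * k), ?_⟩
      simp only [hk]
      ring)
    fun s => ((val s : ℕ) : 𝓞 𝕋)
  have hgs : ∀ s, InBox a b s → ∃ q, g = (val s : ℕ) + q * (1 + (1 + s) * (d : 𝓞 𝕋)) := by
    intro s hs
    obtain ⟨q, hq⟩ := Ideal.mem_span_singleton'.1 (hg ⟨s, hs⟩)
    exact ⟨q, by rw [hq]; ring⟩
  have hsq : ∀ i : ℕ, ∃ z : 𝓞 𝕋, (i : 𝓞 𝕋) = z * z := fun i =>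
    exists_mul_self_iff.2 fun σ => by simp
  have hle : ∀ i : Fin (n + 1), ∃ z : 𝓞 𝕋, (n : 𝓞 𝕋) = (i : ℕ) + z * z := fun i =>
    exists_add_mul_self_iff.2 fun σ => by simpa using Nat.lt_succ_iff.1 i.2
  have hres : ∀ i : Fin (n + 1), IsResidue a b (d : 𝓞 𝕋) g n (i : ℕ) := fun i =>
    ⟨f i, hfb i, hsq i, hle i, by simpa only [hval] using hgs _ (hfb i)⟩
  refine ⟨a, b, d, g, n, hb, hab, hdom, by simpa using hres 0, ?_⟩
  rintro v ⟨s, hs, hv, hv', q, hq⟩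
  obtain ⟨r, hr⟩ := hgs s hs
  have hvs : v = (val s : ℕ) := eq_of_sub_eq_mul hv hv' (hsq _) (hle _) (hdom s hs)
    (q := r - q) (by linear_combination hq.symm.trans hr)
  rcases (Nat.lt_succ_iff.1 (val s).2).eq_or_lt with h | h
  · exact .inl (by rw [hvs, h])
  · right
    have := hres ⟨val s + 1, Nat.succ_lt_succ h⟩
    rw [hvs]
    simpa using this

theorem isNatural_iff {x : 𝓞 𝕋} : IsNatural x ↔ x ∈ Set.range (Nat.cast : ℕ → 𝓞 𝕋) :=
  ⟨mem_range_natCast_of_isNatural, by rintro ⟨n, rfl⟩; exact isNatural_natCast n⟩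

theorem isDef_mem_range_natCast :
    IsDef fun v : Unit → 𝓞 𝕋 => v () ∈ Set.range (Nat.cast : ℕ → 𝓞 𝕋) :=
  isDef_isNatural.congr fun _ => isNatural_iff

end TotallyReal

/-! ### Arithmetization of partial recursive functions and undecidability -/

namespace ringLanguage

section Arithmetic

variable {α β : Type}

/-- A predicate on tuples of natural numbers that is first-order definable in the ring `R`. -/
def IsArith (R : Type*) [CommRing R] (P : (α → ℕ) → Prop) : Prop :=
  ∃ Q : (α → R) → Prop, IsDef Q ∧ ∀ v : α → ℕ, Q (fun a => v a) ↔ P v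

/-- A function on tuples of natural numbers whose graph is first-order definable in `R`. -/
def IsArithFun (R : Type*) [CommRing R] (f : (α → ℕ) → ℕ) : Prop :=
  IsArith R fun w : Option α → ℕ => w none = f fun a => w (some a)

/-- A partial function whose graph is first-order definable in `R`. -/
def IsArithPFun (R : Type*) [CommRing R] (f : ℕ →. ℕ) : Prop :=
  IsArith R fun v : Bool → ℕ => v true ∈ f (v false)

variable {R : Type*} [CommRing R] {P Q : (α → ℕ) → Prop}

namespace IsArith

theorem congr (hP : IsArith R P) (h : ∀ v, P v ↔ Q v) : IsArith R Q := by
  obtain ⟨S, hS, hSP⟩ := hP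
  exact ⟨S, hS, fun v => (hSP v).trans (h v)⟩

theorem not (hP : IsArith R P) : IsArith R fun v => ¬ P v := by
  obtain ⟨S, hS, hSP⟩ := hP
  exact ⟨_, hS.not, fun v => by rw [hSP]⟩

theorem and (hP : IsArith R P) (hQ : IsArith R Q) : IsArith R fun v => P v ∧ Q v := by
  obtain ⟨S, hS, hSP⟩ := hP
  obtain ⟨S', hS', hSQ⟩ := hQ
  exact ⟨_, hS.and hS', fun v => by rw [hSP, hSQ]⟩

theorem or (hP : IsArith R P) (hQ : IsArith R Q) : IsArith R fun v => P v ∨ Q v :=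
  (hP.not.and hQ.not).not.congr fun v => by tauto

theorem imp (hP : IsArith R P) (hQ : IsArith R Q) : IsArith R fun v => P v → Q v :=
  (hP.not.or hQ).congr fun v => by tauto

theorem reindex (hP : IsArith R P) (e : α → β) :
    IsArith R fun v : β → ℕ => P fun a => v (e a) := by
  obtain ⟨S, hS, hSP⟩ := hP
  exact ⟨_, hS.reindex e, fun v => hSP _⟩

end IsArith

theorem IsArithFun.reindex {f : (α → ℕ) → ℕ} (hf : IsArithFun R f) (e : α → β) :
    IsArithFun R fun v : β → ℕ => f fun a => v (e a) :=
  IsArith.reindex hf (Option.map e)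

/-- The natural numbers are definable in `R`. -/
class DefinesNat (R : Type*) [CommRing R] : Prop extends CharZero R where
  isDef_natCast : IsDef fun v : Unit → R => v () ∈ Set.range (Nat.cast : ℕ → R)

variable [DefinesNat R]

namespace IsArith

/-- A quantifier over ℕ becomes a quantifier over `R` relativized to the definable copy of ℕ. -/
theorem ex {P : (α → ℕ) → ℕ → Prop}
    (hP : IsArith R fun w : Option α → ℕ => P (fun a => w (some a)) (w none)) :
    IsArith R fun v => ∃ x, P v x := by
  obtain ⟨S, hS, hSP⟩ := hP
  refine ⟨fun v => ∃ x : R, x ∈ Set.range (Nat.cast : ℕ → R) ∧ S fun o => o.elim x v,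
    IsDef.ex ((DefinesNat.isDef_natCast.subst₁ (.var none)).and (hS.congr fun w =>
      iff_of_eq (congrArg S (funext fun o => by cases o <;> rfl)))), fun v => ?_⟩
  simp only [Set.mem_range, exists_exists_eq_and]
  refine exists_congr fun n => ?_
  refine (iff_of_eq (congrArg S (funext fun o => ?_))).trans (hSP fun o => o.elim n v)
  cases o <;> rfl

theorem all {P : (α → ℕ) → ℕ → Prop}
    (hP : IsArith R fun w : Option α → ℕ => P (fun a => w (some a)) (w none)) :
    IsArith R fun v => ∀ x, P v x :=
  (ex (P := fun v x => ¬ P v x) hP.not).not.congr fun v => by simp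

theorem var_eq (a b : α) : IsArith R fun v : α → ℕ => v a = v b :=
  ⟨_, .eq (.var a) (.var b), fun _ => Nat.cast_inj⟩

theorem var_eq_add (a b c : α) : IsArith R fun v : α → ℕ => v a = v b + v c :=
  ⟨_, .eq (.var a) (.add (.var b) (.var c)), fun _ => by
    rw [← Nat.cast_add, Nat.cast_inj]⟩

theorem var_eq_mul (a b c : α) : IsArith R fun v : α → ℕ => v a = v b * v c :=
  ⟨_, .eq (.var a) (.mul (.var b) (.var c)), fun _ => by
    rw [← Nat.cast_mul, Nat.cast_inj]⟩

/-- Substitution of two functions in a binary relation. -/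
theorem subst₂ {P : ℕ → ℕ → Prop} (hP : IsArith R fun v : Bool → ℕ => P (v false) (v true))
    {f g : (α → ℕ) → ℕ} (hf : IsArithFun R f) (hg : IsArithFun R g) :
    IsArith R fun v => P (f v) (g v) :=
  (ex (P := fun v x => x = f v ∧ ∃ y, y = g v ∧ P x y) (and hf
    (ex (P := fun (w : Option α → ℕ) y => y = g (fun a => w (some a)) ∧ P (w none) y)
      (and (IsArithFun.reindex hg some)
        (hP.reindex fun b => cond b none (some none)))))).congr fun v => by simp

end IsArith

variable {f g h : (α → ℕ) → ℕ}

theorem IsArith.eq (hf : IsArithFun R f) (hg : IsArithFun R g) : IsArith R fun v => f v = g v :=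
  subst₂ (P := fun x y => x = y) (var_eq _ _) hf hg

namespace IsArithFun

theorem var (a : α) : IsArithFun R fun v : α → ℕ => v a := IsArith.var_eq _ _

theorem const (n : ℕ) : IsArithFun R fun _ : α → ℕ => n :=
  ⟨_, .eq (.var none) (.natCast n), fun _ => Nat.cast_inj⟩

theorem comp₂ {F : ℕ → ℕ → ℕ} (hF : IsArithFun R fun v : Bool → ℕ => F (v false) (v true))
    (hf : IsArithFun R f) (hg : IsArithFun R g) : IsArithFun R fun v => F (f v) (g v) :=
  (IsArith.ex (P := fun (w : Option α → ℕ) x => x = f (fun a => w (some a)) ∧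
      ∃ y, y = g (fun a => w (some a)) ∧ w none = F x y)
    (.and (hf.reindex some) (.ex (.and ((hg.reindex some).reindex some)
      (IsArith.reindex hF fun o =>
        o.elim (some (some none)) fun b => cond b none (some none)))))).congr
    fun v => by simp

theorem add (hf : IsArithFun R f) (hg : IsArithFun R g) : IsArithFun R fun v => f v + g v :=
  comp₂ (F := (· + ·)) (IsArith.var_eq_add _ _ _) hf hg

theorem mul (hf : IsArithFun R f) (hg : IsArithFun R g) : IsArithFun R fun v => f v * g v :=
  comp₂ (F := (· * ·)) (IsArith.var_eq_mul _ _ _) hf hg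

end IsArithFun

theorem IsArith.lt (hf : IsArithFun R f) (hg : IsArithFun R g) : IsArith R fun v => f v < g v :=
  (ex (P := fun v k => g v = f v + (k + 1))
    (.eq (hg.reindex _) (.add (hf.reindex _) (.add (.var _) (.const 1))))).congr fun v => by
      constructor
      · rintro ⟨k, hk⟩; omega
      · intro h; exact ⟨g v - f v - 1, by omega⟩

namespace IsArithFun

theorem pair (hf : IsArithFun R f) (hg : IsArithFun R g) :
    IsArithFun R fun v => Nat.pair (f v) (g v) := by
  refine IsArith.congr (((IsArith.lt (hf.reindex some) (hg.reindex some)).and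
    (.eq (.var none) (.add (.mul (hg.reindex some) (hg.reindex some)) (hf.reindex some)))).or
    ((IsArith.lt (hf.reindex some) (hg.reindex some)).not.and
    (.eq (.var none) (.add (.add (.mul (hf.reindex some) (hf.reindex some)) (hf.reindex some))
      (hg.reindex some))))) fun w => ?_
  unfold Nat.pair
  beta_reduce
  split_ifs with h <;> simp [h]

theorem unpair_fst (hf : IsArithFun R f) : IsArithFun R fun v => (Nat.unpair (f v)).1 :=
  (IsArith.ex (P := fun (w : Option α → ℕ) y => f (fun a => w (some a)) = Nat.pair (w none) y)
    (.eq ((hf.reindex some).reindex some) (.pair (.var _) (.var _)))).congr fun w => by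
      constructor
      · rintro ⟨y, hy⟩; simp [hy]
      · intro h; exact ⟨_, by rw [h, Nat.pair_unpair]⟩

theorem unpair_snd (hf : IsArithFun R f) : IsArithFun R fun v => (Nat.unpair (f v)).2 :=
  (IsArith.ex (P := fun (w : Option α → ℕ) y => f (fun a => w (some a)) = Nat.pair y (w none))
    (.eq ((hf.reindex some).reindex some) (.pair (.var _) (.var _)))).congr fun w => by
      constructor
      · rintro ⟨y, hy⟩; simp [hy]
      · intro h; exact ⟨_, by rw [h, Nat.pair_unpair]⟩

/-- The moduli in `Nat.beta` have the form k + 1, so a zero modulus never arises. -/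
theorem mod_succ (hf : IsArithFun R f) (hg : IsArithFun R g) :
    IsArithFun R fun v => f v % (g v + 1) :=
  ((IsArith.lt (.var none) (.add (hg.reindex some) (.const 1))).and
    (IsArith.ex (P := fun (w : Option α → ℕ) q => f (fun a => w (some a)) =
      q * (g (fun a => w (some a)) + 1) + w none)
      (.eq ((hf.reindex some).reindex some) (.add (.mul (.var _)
        (.add ((hg.reindex some).reindex some) (.const 1))) (.var _))))).congr fun w => by
      constructor
      · rintro ⟨h, q, hq⟩
        beta_reduce
        rw [hq, Nat.mul_add_mod_self_right, Nat.mod_eq_of_lt h]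
      · intro h
        rw [h]
        exact ⟨Nat.mod_lt _ (Nat.succ_pos _), _, (Nat.div_add_mod' _ _).symm⟩

theorem beta (hf : IsArithFun R f) (hg : IsArithFun R g) :
    IsArithFun R fun v => Nat.beta (f v) (g v) :=
  hf.unpair_fst.mod_succ (.mul (.add hg (.const 1)) hf.unpair_snd)

end IsArithFun

theorem IsArith.mem {F : ℕ →. ℕ} (hF : IsArithPFun R F) (hf : IsArithFun R f)
    (hg : IsArithFun R g) : IsArith R fun v => g v ∈ F (f v) :=
  subst₂ (P := fun x y => y ∈ F x) hF hf hg

theorem exists_beta_eq (s : ℕ → ℕ) (n : ℕ) : ∃ c, ∀ i ≤ n, Nat.beta c i = s i := by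
  refine ⟨Nat.unbeta ((List.range (n + 1)).map s), fun i hi => ?_⟩
  have := Nat.beta_unbeta_coe ((List.range (n + 1)).map s) ⟨i, by simp; omega⟩
  simpa using this

/-- The finite sequence of intermediate values of the recursion is coded by one number c through the
β-function, which replaces recursion by a first-order condition. -/
theorem mem_prec_iff {F G : ℕ →. ℕ} {a n m : ℕ} :
    m ∈ (Nat.rec (F a) (fun y IH => IH.bind fun i => G (Nat.pair a (Nat.pair y i))) n : Part ℕ) ↔
    ∃ c, Nat.beta c 0 ∈ F a ∧
      (∀ k, k < n → Nat.beta c (k + 1) ∈ G (Nat.pair a (Nat.pair k (Nat.beta c k)))) ∧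
      m = Nat.beta c n := by
  constructor
  · intro h
    obtain ⟨s, h0, hs, rfl⟩ : ∃ s : ℕ → ℕ, s 0 ∈ F a ∧
        (∀ k, k < n → s (k + 1) ∈ G (Nat.pair a (Nat.pair k (s k)))) ∧ m = s n := by
      induction n generalizing m with
      | zero => exact ⟨fun _ => m, h, by simp, rfl⟩
      | succ n ih =>
        obtain ⟨i, hi, hm⟩ := Part.mem_bind_iff.1 h
        obtain ⟨s, h0, hs, rfl⟩ := ih hi
        refine ⟨fun k => if k = n + 1 then m else s k, by simpa using h0, fun k hk => ?_, by simp⟩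
        rcases Nat.lt_succ_iff_lt_or_eq.1 hk with hk | rfl
        · simpa [hk.ne, (hk.trans n.lt_succ_self).ne] using hs k hk
        · simpa using hm
    obtain ⟨c, hc⟩ := exists_beta_eq s n
    refine ⟨c, by rwa [hc 0 n.zero_le], fun k hk => ?_, (hc n le_rfl).symm⟩
    rw [hc k hk.le, hc (k + 1) hk]
    exact hs k hk
  · rintro ⟨c, h0, hs, rfl⟩
    induction n with
    | zero => exact h0
    | succ n ih =>
      exact Part.mem_bind_iff.2 ⟨_, ih fun k hk => hs k (hk.trans n.lt_succ_self),
        hs n n.lt_succ_self⟩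

/-- Partial recursive functions are arithmetical. -/
theorem isArithPFun_of_partrec {F : ℕ →. ℕ} (hF : Nat.Partrec F) : IsArithPFun R F := by
  induction hF with
  | zero => exact (IsArith.eq (.var true) (.const 0)).congr fun v => by simp [pure, PFun.pure]
  | succ =>
    exact (IsArith.eq (.var true) (.add (.var false) (.const 1))).congr fun v => by simp
  | left =>
    exact (IsArith.eq (.var true) (.unpair_fst (.var false))).congr fun v => by simp
  | right =>
    exact (IsArith.eq (.var true) (.unpair_snd (.var false))).congr fun v => by simp
  | @pair f g _ _ hf hg =>
    exact (IsArith.ex (P := fun (v : Bool → ℕ) x => x ∈ f (v false) ∧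
        ∃ y, y ∈ g (v false) ∧ v true = Nat.pair x y)
      (.and (.mem hf (.var _) (.var _)) (.ex (.and (.mem hg (.var _) (.var _))
        (.eq (.var _) (.pair (.var _) (.var _))))))).congr fun v => by simp [Seq.seq, eq_comm]
  | @comp f g _ _ hf hg =>
    exact (IsArith.ex (P := fun (v : Bool → ℕ) x => x ∈ g (v false) ∧ v true ∈ f x)
      (.and (.mem hg (.var _) (.var _)) (.mem hf (.var _) (.var _)))).congr fun v => Part.mem_bind_iff.symm
  | @prec f g _ _ hf hg =>
    exact (IsArith.ex (P := fun (v : Bool → ℕ) c => Nat.beta c 0 ∈ f (Nat.unpair (v false)).1 ∧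
        (∀ k, k < (Nat.unpair (v false)).2 → Nat.beta c (k + 1) ∈
          g (Nat.pair (Nat.unpair (v false)).1 (Nat.pair k (Nat.beta c k)))) ∧
        v true = Nat.beta c (Nat.unpair (v false)).2)
      (.and (.mem hf (.unpair_fst (.var _)) (.beta (.var _) (.const 0)))
      (.and (.all (.imp (.lt (.var _) (.unpair_snd (.var _)))
        (.mem hg (.pair (.unpair_fst (.var _)) (.pair (.var _) (.beta (.var _) (.var _))))
          (.beta (.var _) (.add (.var _) (.const 1))))))
      (.eq (.var _) (.beta (.var _) (.unpair_snd (.var _))))))).congr fun v => mem_prec_iff.symm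
  | @rfind f _ hf =>
    -- Minimization requires every earlier value to be defined and nonzero, that is, of the form y +
    -- 1.
    have h : IsArith R fun v : Bool → ℕ => ∀ k, k < v true →
        ∃ y, y + 1 ∈ f (Nat.pair (v false) k) :=
      .all (.imp (.lt (.var _) (.var _))
        (.ex (.mem hf (.pair (.var _) (.var _)) (.add (.var _) (.const 1)))))
    refine (IsArith.and (.mem hf (.pair (.var false) (.var true)) (.const 0)) h).congr fun v => ?_
    refine Iff.trans ?_ Nat.mem_rfind.symm
    simp only [Part.map_eq_map, Part.mem_map_iff, decide_eq_true_eq, decide_eq_false_iff_not]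
    refine and_congr (by simp) (forall_congr' fun k => forall_congr' fun _ => ?_)
    constructor
    · rintro ⟨y, hy⟩; exact ⟨_, hy, y.succ_ne_zero⟩
    · rintro ⟨y, hy, hy0⟩
      exact ⟨y - 1, by rwa [Nat.sub_add_cancel (Nat.pos_of_ne_zero hy0)]⟩

/-- The term `((0 + 1) + ⋯) + 1`. -/
def numeral : ℕ → ringLanguage.Term (Empty ⊕ Fin 1)
  | 0 => .func (l := 0) RingSymbol.zero Fin.elim0
  | n + 1 => .func (l := 2) RingSymbol.add
      ![numeral n, .func (l := 0) RingSymbol.one Fin.elim0]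

theorem realize_numeral {S : Type*} [CommRing S] (n : ℕ) (v : Empty ⊕ Fin 1 → S) :
    (numeral n).realize v = n := by
  induction n with
  | zero => rw [Nat.cast_zero]; rfl
  | succ n ih =>
    rw [Nat.cast_succ, ← ih]; rfl

theorem primrec_termCode_numeral : Primrec fun n => termCode (numeral n) := by
  have : (fun n => termCode (numeral n)) = fun n => Nat.rec (Nat.pair 1 0)
      (fun _ c => Nat.pair 3 (Nat.pair c (Nat.pair 2 0))) n := by
    funext n
    induction n with
    | zero => rfl
    | succ n ih => simp only [← ih]; rfl
  rw [this]
  exact Primrec.nat_rec₁ _ (Primrec₂.natPair.comp (Primrec.const 3)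
    (Primrec₂.natPair.comp Primrec.snd (Primrec.const _))).to₂

/-- The sentence stating that `φ` holds of the natural number `n`. -/
def instanceSentence (φ : ringLanguage.BoundedFormula Empty 1) (n : ℕ) : ringLanguage.Sentence :=
  .all (.imp (.equal (.var (.inr 0)) (numeral n)) φ)

/-- Since n enters only through the numeral in an equation, no substitution into `φ` has to be
computed. -/
theorem primrec_godelNumber_instanceSentence (φ : ringLanguage.BoundedFormula Empty 1) :
    Primrec fun n => godelNumber (instanceSentence φ n) := by
  change Primrec fun n => Nat.pair 3 (Nat.pair 2 (Nat.pair (Nat.pair 1 (Nat.pair (Nat.pair 0 0)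
    (termCode (numeral n)))) (formulaCode φ)))
  exact Primrec₂.natPair.comp (.const 3) (Primrec₂.natPair.comp (.const 2) (Primrec₂.natPair.comp
    (Primrec₂.natPair.comp (.const 1) (Primrec₂.natPair.comp (.const _) primrec_termCode_numeral))
    (.const _)))

/-- A ring in which the natural numbers are definable has an undecidable theory. -/
theorem not_decidableTheory_completeTheory :
    ¬ DecidableTheory (ringLanguage.completeTheory R) := by
  rintro ⟨f, hf, hfS⟩
  let F : ℕ →. ℕ := fun n => (Denumerable.ofNat Nat.Partrec.Code n).eval 0
  have hF : Nat.Partrec F := Partrec.nat_iff.1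
    (Nat.Partrec.Code.eval_part.comp (Computable.ofNat _) (Computable.const 0))
  have hdom : IsArith R fun v : Fin 1 → ℕ => (F (v 0)).Dom :=
    (IsArith.ex (.mem (isArithPFun_of_partrec hF) (.var (some 0)) (.var none))).congr fun v =>
      Part.dom_iff_mem.symm
  obtain ⟨Q, ⟨φ, hφ⟩, hQ⟩ := hdom
  let s : ℕ → ringLanguage.Sentence :=
    instanceSentence (Language.BoundedFormula.relabel (Sum.inr : Fin 1 → Empty ⊕ Fin 1) φ)
  have hs : ∀ n, s n ∈ ringLanguage.completeTheory R ↔ (F n).Dom := by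
    intro n
    rw [Language.mem_completeTheory]
    have h1 : (R ⊨ s n) ↔ ∀ x : R, x = n → Q fun _ => x := by
      refine forall_congr' fun x => imp_congr ?_ ?_
      · rw [← realize_numeral n (Sum.elim default (Fin.snoc default x))]
        rfl
      · rw [Language.Formula.realize_relabel_sumInr, hφ]
        exact iff_of_eq (congrArg Q (funext fun i => by fin_cases i; rfl))
    rw [h1, forall_eq, hQ fun _ => n]
  -- Running the supposed decision procedure on the sentence for the code c would decide whether c
  -- halts on input 0.
  refine ComputablePred.halting_problem 0 ?_
  classical
  refine ⟨fun c => inferInstance, ?_⟩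
  refine Partrec.of_eq_tot (f := fun c : Nat.Partrec.Code => f (godelNumber (s (Encodable.encode c))))
    (hf.comp ((primrec_godelNumber_instanceSentence _).to_comp.comp Computable.encode)) fun c => ?_
  have h2 : (F (Encodable.encode c)).Dom ↔ (c.eval 0).Dom := by simp [F]
  by_cases hc : (c.eval 0).Dom
  · simpa [hc] using (hfS _).1 ((hs _).2 (h2.2 hc))
  · simpa [hc] using (hfS _).2 (mt (hs _).1 (mt h2.1 hc))

end Arithmetic

end ringLanguage

namespace TotallyReal

instance : ringLanguage.DefinesNat (𝓞 𝕋) where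
  isDef_natCast := isDef_mem_range_natCast

end TotallyReal

theorem mainTheorem8 :
    -- the first-order theory of the ring of integers of `T` is undecidable
    ¬ ringLanguage.DecidableTheory (ringLanguage.completeTheory (𝓞 totallyRealNumbers)) ∧
    -- the set of natural numbers is definable in it, without parameters
    (∅ : Set (𝓞 totallyRealNumbers)).Definable₁ ringLanguage
      (Set.range (Nat.cast : ℕ → 𝓞 totallyRealNumbers)) ∧
    -- `4` is the least real `M` with infinitely many `t` such that `0 ≪ t ≪ M`
    IsLeast {M : ℝ | {t : 𝓞 totallyRealNumbers | ∀ σ : totallyRealNumbers →+* ℝ,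
      0 < σ (t : totallyRealNumbers) ∧ σ (t : totallyRealNumbers) < M}.Infinite} 4 :=
  ⟨ringLanguage.not_decidableTheory_completeTheory,
    TotallyReal.isDef_mem_range_natCast.definable₁, TotallyReal.isLeast_four⟩
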